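/- Let $\mathrm{Vec}(\mathbb R)$ be the Lie algebra of polynomial vector fields $g\,\partial_x$, $g\in\mathbb C[x]$, on the line. For $\lambda,\mu,k\in\mathbb C$ put $\delta=\mu-\lambda$ and let $\Psi^k_{\lambda,\mu}$ be the space of formal sums $dx^{\delta}\sum_{i\ge 0} f_i(x)\,\partial_x^{k-i}$ with $f_i\in\mathbb C[x]$ (formal pseudodifferential operators from $\lambda$-densities to $\mu$-densities), with the $\mathrm{Vec}(\mathbb R)$-action $$L(g\partial_x)\bigl(dx^\delta f\partial_x^r\bigr)=dx^\delta\Bigl\{\bigl(gf'+(\delta-r)g'f\bigr)\partial_x^r-f\sum_{s\ge1}\binom rs\Bigl(\lambda+\frac{r-s}{s+1}\Bigr)g^{(s+1)}\partial_x^{r-s}\Bigr\}.$$ For an integer $l\ge 1$ let $SQ^{k,l}_{\lambda,\mu}=\Psi^k_{\lambda,\mu}/\Psi^{k-l}_{\lambda,\mu}$, a $\mathrm{Vec}(\mathbb R)$-module. Write $\gamma=3(\lambda+\mu-1)^2$, $\gamma^{1/2}=\sqrt3(\lambda+\mu-1)$, $(x)_r=x(x-1)\cdots(x-r+1)$, and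 for a second pair $(\lambda',\mu')\in\mathbb C^2$ let $\gamma',\delta'$ be the corresponding parameters. Equivalence means isomorphism of $\mathrm{Vec}(\mathbb R)$-modules. **Theorem.** Consider the length $4$ modules $SQ^{\delta+1,4}_{\lambda,\mu}$ and $SQ^{\delta'+1,4}_{\lambda',\mu'}$ and the four functions $$\delta\gamma^{1/2},\qquad(\delta+1)_3\,\gamma^{1/2}(\gamma-3),\qquad(\delta)_2\,(\gamma-\delta-1),\qquad(\delta+1)_2\,(\gamma+\delta-1).$$ 1. If the two modules are equivalent, then they satisfy the simultaneous vanishing condition (SVC): each of the four functions vanishes at $(\lambda,\mu)$ if and only if it vanishes at $(\lambda',\mu')$. 2. If at least one of the four functions vanishes at both $(\lambda,\mu)$ and $(\lambda',\mu')$, then the SVC is also sufficient for equivalence. 3. If none of the four functions vanishes at $(\lambda,\mu)$ or at $(\lambda',\mu')$, then the modules are equivalent if and only if $R(\gamma,\delta)=R(\gamma',\delta')$, where $$R(\gamma,\delta)=\frac{\gamma(\gamma-3)}{(\gamma-\delta-1)(\gamma+\delta-1)}.$$ 4. The level curves of $R$ form a pencil of conics in the $(\gamma,\delta)$-plane $\mathbb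 C^2$: a polynomial of degree at most $2$ in $(\gamma,\delta)$ vanishes at the four points $(0,\pm1)$, $(3,\pm2)$ if and only if it is a linear combination of $\gamma(\gamma-3)$ and $(\gamma-\delta-1)(\gamma+\delta-1)$; and for every $c\in\mathbb C$ the set of points where $(\gamma-\delta-1)(\gamma+\delta-1)\neq0$ and $R=c$ is the conic $\gamma(\gamma-3)=c\,(\gamma-\delta-1)(\gamma+\delta-1)$ with these four points removed. -/

import Mathlib

noncomputable section

namespace PseudoDiff

open Polynomial Finset Finset.HasAntidiagonal

/-! ### Polynomial vector fields on the line -/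

/-- The Lie algebra of polynomial vector fields on the line, with complex coefficients.
The vector field `g ∂ₓ` is the derivation sending `X` to `g`; the bracket is the commutator. -/
abbrev VecR : Type := Derivation ℂ ℂ[X] ℂ[X]

lemma vecR_apply (D : VecR) (p : ℂ[X]) : D p = derivative p * D X := by
  have h : D = (D X) • (derivative' (R := ℂ)) := by
    apply derivation_ext
    simp [derivative']
  conv_lhs => rw [h]
  simp [derivative', mul_comm]

lemma vecR_lie_X (D E : VecR) :
    ⁅D, E⁆ X = D X * derivative (E X) - E X * derivative (D X) := by
  rw [Derivation.commutator_apply, vecR_apply D (E X), vecR_apply E (D X)]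
  ring

/-! ### The action on formal pseudodifferential operators -/

/-- Let `δ = μ - λ`. The vector field `g ∂ₓ` acts on the one-term operator `dx^δ f ∂ₓ^r` by
`dx^δ { (g f' + (δ - r) g' f) ∂ₓ^r
  - f ∑_{s ≥ 1} (r choose s) (λ + (r - s) / (s + 1)) g^(s+1) ∂ₓ^(r-s) }`,
the expansion of `(g ∂ₓ + μ g') ∘ f ∂ₓ^r - f ∂ₓ^r ∘ (g ∂ₓ + λ g')`.
`psiAction k lam mu g f i` is the coefficient of `∂ₓ^(k-i)` in the result of applying `g ∂ₓ` to
the formal sum `dx^δ ∑_j f_j ∂ₓ^(k-j)`. Besides the diagonal term, it receives for each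
`1 ≤ s ≤ i` a contribution of the term `f_{i-s} ∂ₓ^r` with `r = k - (i - s)`. -/
def psiAction (k lam mu : ℂ) (g : ℂ[X]) (f : ℕ → ℂ[X]) (i : ℕ) : ℂ[X] :=
  g * derivative (f i) + C ((mu - lam) - (k - i)) * derivative g * f i
    - ∑ s ∈ Finset.Icc 1 i,
        C (Ring.choose (k - ((i - s : ℕ) : ℂ)) s *
            (lam + ((k - ((i - s : ℕ) : ℂ)) - s) / (s + 1))) *
          derivative^[s + 1] g * f (i - s)

section ActionLaws

variable (lam mu r k : ℂ)

/-- Auxiliary: minus the coefficients in the sum above, and the diagonal coefficient. -/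
def wt (s : ℕ) : ℂ :=
  if s = 0 then (mu - lam) - r else -(Ring.choose r s * (lam + (r - s) / (s + 1)))

lemma psiAction_eq (k lam mu : ℂ) (g : ℂ[X]) (f : ℕ → ℂ[X]) (i : ℕ) :
    psiAction k lam mu g f i = g * derivative (f i) +
      ∑ q ∈ antidiagonal i,
        C (wt lam mu (k - q.2) q.1) * derivative^[q.1 + 1] g * f q.2 := by
  have h : ∑ s ∈ Finset.Icc 1 i,
      C (wt lam mu (k - ((i - s : ℕ) : ℂ)) s) * derivative^[s + 1] g * f (i - s)
      = - ∑ s ∈ Finset.Icc 1 i,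
        C (Ring.choose (k - ((i - s : ℕ) : ℂ)) s *
            (lam + ((k - ((i - s : ℕ) : ℂ)) - s) / (s + 1))) *
          derivative^[s + 1] g * f (i - s) := by
    rw [← Finset.sum_neg_distrib]
    refine Finset.sum_congr rfl fun s hs => ?_
    have : s ≠ 0 := by have := (Finset.mem_Icc.1 hs).1; omega
    rw [wt, if_neg this, C_neg]
    ring
  rw [Finset.Nat.sum_antidiagonal_eq_sum_range_succ_mk, psiAction, sub_eq_add_neg, ← h,
    Finset.range_eq_Ico, Finset.sum_eq_sum_Ico_succ_bot (Nat.succ_pos i)]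
  have e : Finset.Ico (0 + 1) i.succ = Finset.Icc 1 i := by ext; simp
  rw [e]
  simp [wt, add_assoc]

lemma dp_mul (r : ℂ) (s t : ℕ) :
    (descPochhammer ℂ t).eval r * (descPochhammer ℂ s).eval (r - t)
      = (descPochhammer ℂ (s + t)).eval r := by
  rw [add_comm, ← descPochhammer_mul]
  simp

lemma choose_eq (r : ℂ) (s : ℕ) :
    Ring.choose r s = (descPochhammer ℂ s).eval r / (s.factorial : ℂ) := by
  rw [Ring.choose_eq_smul, smul_eq_mul, ← aeval_eq_smeval, ← descPochhammer_map (algebraMap ℤ ℂ), eval_map_algebraMap]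
  ring

/-- Auxiliary: a uniform expression for the coefficients of `wt`. -/
def cf (s : ℕ) : ℂ :=
  (descPochhammer ℂ s).eval r / ((s + 1).factorial : ℂ) * (r - s + lam * (s + 1))

lemma wt_eq (s : ℕ) : wt lam mu r s = (if s = 0 then mu else 0) - cf lam r s := by
  rw [wt, cf]
  split_ifs with h
  · subst h; simp; ring
  · rw [choose_eq, Nat.factorial_succ]
    have : (s.factorial : ℂ) ≠ 0 := by exact_mod_cast s.factorial_ne_zero
    have : (s : ℂ) + 1 ≠ 0 := by exact_mod_cast s.succ_ne_zero
    push_cast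
    field_simp
    ring

lemma cf_comm (s t : ℕ) :
    cf lam r t * cf lam (r - t) s - cf lam r s * cf lam (r - s) t
      = - (cf lam r (s + t) *
        (((s + t + 1).choose (s + 1) : ℂ) - ((s + t + 1).choose (t + 1) : ℂ))) := by
  have h1 : ((s + t + 1).choose (s + 1) : ℂ) =
      (s + t + 1).factorial / ((s + 1).factorial * t.factorial) := by
    rw [Nat.cast_choose ℂ (by omega)]; congr 4; omega
  have h2 : ((s + t + 1).choose (t + 1) : ℂ) =
      (s + t + 1).factorial / ((t + 1).factorial * s.factorial) := by
    rw [Nat.cast_choose ℂ (by omega)]; congr 4; omega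
  simp only [h1, h2, cf]
  have a1 : (s.factorial : ℂ) ≠ 0 := by exact_mod_cast (s).factorial_ne_zero
  have a2 : (t.factorial : ℂ) ≠ 0 := by exact_mod_cast (t).factorial_ne_zero
  have a3 : ((s + t + 1).factorial : ℂ) ≠ 0 := by exact_mod_cast (s + t + 1).factorial_ne_zero
  have a4 : (s : ℂ) + 1 ≠ 0 := by exact_mod_cast s.succ_ne_zero
  have a5 : (t : ℂ) + 1 ≠ 0 := by exact_mod_cast t.succ_ne_zero
  have e1 := dp_mul r s t
  have e2 := dp_mul r t s
  rw [add_comm t s] at e2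
  generalize (descPochhammer ℂ (s + t)).eval r = P at *
  rw [Nat.factorial_succ s, Nat.factorial_succ t]
  generalize ((s + t + 1).factorial : ℂ) = F at *
  push_cast
  calc _ = ((descPochhammer ℂ t).eval r * (descPochhammer ℂ s).eval (r - t)) *
        ((r - t + lam * (t + 1)) * (r - t - s + lam * (s + 1))) /
          ((t + 1) * t.factorial * ((s + 1) * s.factorial)) -
        ((descPochhammer ℂ s).eval r * (descPochhammer ℂ t).eval (r - s)) *
        ((r - s + lam * (s + 1)) * (r - s - t + lam * (t + 1))) /
          ((t + 1) * t.factorial * ((s + 1) * s.factorial)) := by field_simp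
    _ = _ := by
      rw [e1, e2]; field_simp; ring

lemma wt_comm (s t : ℕ) :
    wt lam mu r t * wt lam mu (r - t) s - wt lam mu r s * wt lam mu (r - s) t
      = wt lam mu r (s + t) *
        (((s + t + 1).choose (s + 1) : ℂ) - ((s + t + 1).choose (t + 1) : ℂ)) := by
  have h := cf_comm lam r s t
  rcases Nat.eq_zero_or_pos s with rfl | hs
  · rcases Nat.eq_zero_or_pos t with rfl | ht
    · simp
    · have : t ≠ 0 := by omega
      simp [wt_eq, this] at h ⊢
      linear_combination h
  · rcases Nat.eq_zero_or_pos t with rfl | ht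
    · have : s ≠ 0 := by omega
      simp [wt_eq, this] at h ⊢
      linear_combination h
    · have hs' : s ≠ 0 := by omega
      have ht' : t ≠ 0 := by omega
      simp only [wt_eq, hs', ht', if_false, zero_sub, Nat.add_eq_zero_iff, false_and]
      linear_combination h

lemma iter_mul (N : ℕ) (g h : ℂ[X]) :
    derivative^[N + 1] (g * derivative h) = g * derivative^[N + 2] h +
      ∑ q ∈ antidiagonal N, C ((N + 1).choose (q.1 + 1) : ℂ) *
        derivative^[q.1 + 1] g * derivative^[q.2 + 1] h := by
  rw [mul_comm g, iterate_derivative_mul,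
    ← Finset.Nat.sum_antidiagonal_eq_sum_range_succ
      (fun a b => (N + 1).choose a • (derivative^[b] (derivative h) * derivative^[a] g)),
    Finset.Nat.sum_antidiagonal_succ]
  congr 1
  · simp only [Nat.choose_zero_right, one_smul, Function.iterate_zero, id, mul_comm,
      ← Function.iterate_succ_apply, Nat.succ_eq_add_one]
  · refine Finset.sum_congr rfl fun q _ => ?_
    simp only [← Function.iterate_succ_apply, nsmul_eq_mul, map_natCast]
    ring

lemma anti_triple (i : ℕ) (F : ℕ → ℕ → ℕ → ℂ[X]) :
    ∑ q ∈ antidiagonal i, ∑ p ∈ antidiagonal q.2, F q.1 p.1 p.2 =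
      ∑ q ∈ antidiagonal i, ∑ p ∈ antidiagonal q.1, F p.1 p.2 q.2 := by
  simp only [Finset.sum_sigma']
  apply Finset.sum_nbij' (fun ⟨⟨i, _⟩, ⟨k, l⟩⟩ ↦ ⟨(i + k, l), (i, k)⟩)
    (fun ⟨⟨_, j⟩, ⟨k, l⟩⟩ ↦ ⟨(k, l + j), (l, j)⟩) <;>
  · rintro ⟨⟨a, b⟩, ⟨c, d⟩⟩ h
    simp at h
    obtain ⟨rfl, rfl⟩ := h
    simp [add_assoc]

lemma key (N : ℕ) (g h : ℂ[X]) :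
    ∑ q ∈ antidiagonal N, (C (wt lam mu r q.2 * wt lam mu (r - q.2) q.1) *
        (derivative^[q.1 + 1] g * derivative^[q.2 + 1] h
          - derivative^[q.1 + 1] h * derivative^[q.2 + 1] g)) +
      C (wt lam mu r N) * (g * derivative^[N + 2] h - h * derivative^[N + 2] g) =
    C (wt lam mu r N) * derivative^[N + 1] (g * derivative h - h * derivative g) := by
  have hs : ∑ q ∈ antidiagonal N, C (wt lam mu r q.2 * wt lam mu (r - q.2) q.1) *
        (derivative^[q.1 + 1] h * derivative^[q.2 + 1] g) =
      ∑ q ∈ antidiagonal N, C (wt lam mu r q.1 * wt lam mu (r - q.1) q.2) *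
        (derivative^[q.1 + 1] g * derivative^[q.2 + 1] h) := by
    rw [← Finset.Nat.sum_antidiagonal_swap]
    refine Finset.sum_congr rfl fun q _ => ?_
    simp only [Prod.fst_swap, Prod.snd_swap]
    ring
  have hs2 : ∑ q ∈ antidiagonal N, C ((N + 1).choose (q.1 + 1) : ℂ) *
        derivative^[q.1 + 1] h * derivative^[q.2 + 1] g =
      ∑ q ∈ antidiagonal N, C ((N + 1).choose (q.2 + 1) : ℂ) *
        derivative^[q.1 + 1] g * derivative^[q.2 + 1] h := by
    rw [← Finset.Nat.sum_antidiagonal_swap]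
    refine Finset.sum_congr rfl fun q _ => ?_
    simp only [Prod.fst_swap, Prod.snd_swap]
    ring
  rw [iterate_derivative_sub, iter_mul, iter_mul, hs2]
  simp only [mul_sub, Finset.sum_sub_distrib]
  rw [hs, ← Finset.sum_sub_distrib]
  have : ∑ q ∈ antidiagonal N, (C (wt lam mu r q.2 * wt lam mu (r - q.2) q.1) *
        (derivative^[q.1 + 1] g * derivative^[q.2 + 1] h) -
        C (wt lam mu r q.1 * wt lam mu (r - q.1) q.2) *
        (derivative^[q.1 + 1] g * derivative^[q.2 + 1] h)) =
      C (wt lam mu r N) * (∑ q ∈ antidiagonal N, C ((N + 1).choose (q.1 + 1) : ℂ) *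
        derivative^[q.1 + 1] g * derivative^[q.2 + 1] h - 
        ∑ q ∈ antidiagonal N, C ((N + 1).choose (q.2 + 1) : ℂ) *
        derivative^[q.1 + 1] g * derivative^[q.2 + 1] h) := by
    rw [← Finset.sum_sub_distrib, Finset.mul_sum]
    refine Finset.sum_congr rfl fun q hq => ?_
    obtain rfl := mem_antidiagonal.1 hq
    rw [← sub_mul, ← C_sub, wt_comm, C_mul, C_sub]
    ring
  rw [this]
  ring

lemma psiAction_bracket (g h : ℂ[X]) (f : ℕ → ℂ[X]) (i : ℕ) :
    psiAction k lam mu (g * derivative h - h * derivative g) f i =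
      psiAction k lam mu g (psiAction k lam mu h f) i
        - psiAction k lam mu h (psiAction k lam mu g f) i := by
  have expand : ∀ g h : ℂ[X], psiAction k lam mu g (psiAction k lam mu h f) i =
      g * derivative (h * derivative (f i)) +
      ∑ q ∈ antidiagonal i, C (wt lam mu (k - q.2) q.1) * (g * derivative^[q.1 + 2] h * f q.2) +
      ∑ q ∈ antidiagonal i, C (wt lam mu (k - q.2) q.1) *
        ((g * derivative^[q.1 + 1] h + h * derivative^[q.1 + 1] g) * derivative (f q.2)) +
      ∑ q ∈ antidiagonal i, ∑ p ∈ antidiagonal q.1,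
        C (wt lam mu (k - q.2) p.2 * wt lam mu (k - q.2 - p.2) p.1) *
          (derivative^[p.1 + 1] g * derivative^[p.2 + 1] h) * f q.2 := by
    intro g h
    rw [← anti_triple i (fun a b c => C (wt lam mu (k - c) b * wt lam mu (k - c - b) a) *
          (derivative^[a + 1] g * derivative^[b + 1] h) * f c), psiAction_eq]
    simp only [psiAction_eq k lam mu h f, derivative_add, derivative_sum, mul_add, Finset.mul_sum,
      Finset.sum_add_distrib, add_mul]
    have e3 : ∀ q ∈ antidiagonal i, ∀ p ∈ antidiagonal q.2,
        C (wt lam mu (k - q.2) q.1) * derivative^[q.1 + 1] g *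
          (C (wt lam mu (k - p.2) p.1) * derivative^[p.1 + 1] h * f p.2) =
        C (wt lam mu (k - p.2) p.1 * wt lam mu (k - p.2 - p.1) q.1) *
          (derivative^[q.1 + 1] g * derivative^[p.1 + 1] h) * f p.2 := by
      intro q _ p hp
      have : (k - q.2 : ℂ) = k - p.2 - p.1 := by
        rw [← mem_antidiagonal.1 hp]; push_cast; ring
      rw [this, C_mul]; ring
    rw [Finset.sum_congr rfl fun q hq => Finset.sum_congr rfl (e3 q hq)]
    have e1 : ∀ q ∈ antidiagonal i,
        g * derivative (C (wt lam mu (k - q.2) q.1) * derivative^[q.1 + 1] h * f q.2) =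
        C (wt lam mu (k - q.2) q.1) * (g * derivative^[q.1 + 2] h * f q.2) +
        C (wt lam mu (k - q.2) q.1) * (g * derivative^[q.1 + 1] h * derivative (f q.2)) := by
      intro q _
      rw [derivative_mul, derivative_mul, derivative_C,
        Function.iterate_succ_apply' _ (q.1 + 1)]
      ring
    rw [Finset.sum_congr rfl e1, Finset.sum_add_distrib]
    have e2 : ∀ q ∈ antidiagonal i,
        C (wt lam mu (k - q.2) q.1) * derivative^[q.1 + 1] g * (h * derivative (f q.2)) =
        C (wt lam mu (k - q.2) q.1) * (h * derivative^[q.1 + 1] g * derivative (f q.2)) := by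
      intro q _; ring
    rw [Finset.sum_congr rfl e2]
    ring
  have k2 : ∀ q ∈ antidiagonal i,
      C (wt lam mu (k - q.2) q.1) * derivative^[q.1 + 1] (g * derivative h - h * derivative g)
        * f q.2 = 
      ∑ p ∈ antidiagonal q.1,
        C (wt lam mu (k - q.2) p.2 * wt lam mu (k - q.2 - p.2) p.1) *
          (derivative^[p.1 + 1] g * derivative^[p.2 + 1] h) * f q.2 -
      ∑ p ∈ antidiagonal q.1,
        C (wt lam mu (k - q.2) p.2 * wt lam mu (k - q.2 - p.2) p.1) *
          (derivative^[p.1 + 1] h * derivative^[p.2 + 1] g) * f q.2 +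
      C (wt lam mu (k - q.2) q.1) * (g * derivative^[q.1 + 2] h * f q.2) -
      C (wt lam mu (k - q.2) q.1) * (h * derivative^[q.1 + 2] g * f q.2) := by
    intro q _
    rw [← key, ← Finset.sum_sub_distrib]
    simp only [add_mul, Finset.sum_mul, mul_sub, sub_mul]
    ring
  rw [expand, expand, psiAction_eq, Finset.sum_congr rfl k2]
  simp only [Finset.sum_add_distrib, Finset.sum_sub_distrib, derivative_mul, mul_add, add_mul]
  ring

lemma psiAction_add_left (g h : ℂ[X]) (f : ℕ → ℂ[X]) (i : ℕ) :
    psiAction k lam mu (g + h) f i = psiAction k lam mu g f i + psiAction k lam mu h f i := by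
  simp only [psiAction_eq, iterate_map_add, add_mul, mul_add, Finset.sum_add_distrib]
  ring

lemma psiAction_add_right (g : ℂ[X]) (f f' : ℕ → ℂ[X]) (i : ℕ) :
    psiAction k lam mu g (f + f') i = psiAction k lam mu g f i + psiAction k lam mu g f' i := by
  simp only [psiAction_eq, Pi.add_apply, derivative_add, mul_add, Finset.sum_add_distrib]
  ring

lemma psiAction_smul_left (c : ℂ) (g : ℂ[X]) (f : ℕ → ℂ[X]) (i : ℕ) :
    psiAction k lam mu (c • g) f i = c • psiAction k lam mu g f i := by
  simp only [psiAction_eq, iterate_derivative_smul, smul_add, Finset.smul_sum, smul_mul_assoc,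
    mul_smul_comm]

lemma psiAction_smul_right (c : ℂ) (g : ℂ[X]) (f : ℕ → ℂ[X]) (i : ℕ) :
    psiAction k lam mu g (c • f) i = c • psiAction k lam mu g f i := by
  simp only [psiAction_eq, Pi.smul_apply, derivative_smul, smul_add, Finset.smul_sum,
    mul_smul_comm]

lemma psiAction_eq_zero (g : ℂ[X]) (f : ℕ → ℂ[X]) (i : ℕ) (hf : ∀ j ≤ i, f j = 0) :
    psiAction k lam mu g f i = 0 := by
  rw [psiAction, hf i le_rfl, Finset.sum_eq_zero]
  · simp
  · intro s _
    rw [hf (i - s) (Nat.sub_le i s), mul_zero]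

end ActionLaws

/-- `Ψ^k_{λ,μ}`: formal pseudodifferential operators of order in `k - ℕ` from `λ`-densities to
`μ`-densities. The sequence `f` stands for the formal sum `dx^(μ-λ) ∑_i f_i(x) ∂ₓ^(k-i)`. -/
def Psi (_k _lam _mu : ℂ) : Type := ℕ → ℂ[X]

instance (k lam mu : ℂ) : AddCommGroup (Psi k lam mu) :=
  inferInstanceAs (AddCommGroup (ℕ → ℂ[X]))

instance (k lam mu : ℂ) : Module ℂ (Psi k lam mu) :=
  inferInstanceAs (Module ℂ (ℕ → ℂ[X]))

instance (k lam mu : ℂ) : LieRingModule VecR (Psi k lam mu) where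
  bracket D f := psiAction k lam mu (D X) f
  add_lie D E f := funext fun i => psiAction_add_left lam mu k (D X) (E X) f i
  lie_add D f f' := funext fun i => psiAction_add_right lam mu k (D X) f f' i
  leibniz_lie D E f := funext fun i => by
    have h := psiAction_bracket lam mu k (D X) (E X) f i
    rw [← vecR_lie_X] at h
    exact (sub_eq_iff_eq_add.1 h.symm)

instance (k lam mu : ℂ) : LieModule ℂ VecR (Psi k lam mu) where
  smul_lie c D f := funext fun i => psiAction_smul_left lam mu k c (D X) f i
  lie_smul c D f := funext fun i => psiAction_smul_right lam mu k c (D X) f i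

/-- `Ψ^(k-l)_{λ,μ}` as a submodule of `Ψ^k_{λ,μ}`: the first `l` coefficients vanish. -/
def lowerOrder (k lam mu : ℂ) (l : ℕ) : LieSubmodule ℂ VecR (Psi k lam mu) where
  carrier := {f | ∀ i < l, f i = 0}
  add_mem' {f f'} hf hf' i hi := by
    change f i + f' i = 0
    rw [hf i hi, hf' i hi, add_zero]
  zero_mem' i _ := rfl
  smul_mem' c f hf i hi := by
    change c • f i = 0
    rw [hf i hi, smul_zero]
  lie_mem {D f} hf i hi :=
    psiAction_eq_zero lam mu k (D X) f i fun j hj => hf j (lt_of_le_of_lt hj hi)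

/-- The subquotient `SQ^{k,l}_{λ,μ} = Ψ^k_{λ,μ} / Ψ^(k-l)_{λ,μ}`, a module over `VecR`. -/
abbrev SQ (k : ℂ) (l : ℕ) (lam mu : ℂ) : Type := Psi k lam mu ⧸ lowerOrder k lam mu l

/-! ### The parameters and the invariants -/

/-- `δ = μ - λ`. -/
def delta (lam mu : ℂ) : ℂ := mu - lam

/-- `γ^(1/2) = √3 (λ + μ - 1)`. -/
def sqrtGamma (lam mu : ℂ) : ℂ := (Real.sqrt 3 : ℂ) * (lam + mu - 1)

/-- `γ = 3 (λ + μ - 1)²`. -/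
def gamma (lam mu : ℂ) : ℂ := 3 * (lam + mu - 1) ^ 2

/-- The falling factorial `(x)_r = x (x - 1) ⋯ (x - r + 1)`. -/
def fall (x : ℂ) (r : ℕ) : ℂ := (descPochhammer ℂ r).eval x

/-- The subquotient `SQ^{δ+1,4}_{λ,μ}`, with composition series `F₋₁, F₀, F₁, F₂`. -/
abbrev SelfDualSQ (lam mu : ℂ) : Type := SQ (delta lam mu + 1) 4 lam mu

/-- Equivalence of `SQ^{δ+1,4}_{λ,μ}` and `SQ^{δ'+1,4}_{λ',μ'}` as modules over `VecR`. -/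
def Equivalent (lam mu lam' mu' : ℂ) : Prop :=
  Nonempty (SelfDualSQ lam mu ≃ₗ⁅ℂ,VecR⁆ SelfDualSQ lam' mu')

/-- The four functions `δ γ^(1/2)`, `(δ+1)₃ γ^(1/2) (γ-3)`, `(δ)₂ (γ-δ-1)`,
`(δ+1)₂ (γ+δ-1)`. -/
def svcFunction (lam mu : ℂ) : Fin 4 → ℂ :=
  ![delta lam mu * sqrtGamma lam mu,
    fall (delta lam mu + 1) 3 * sqrtGamma lam mu * (gamma lam mu - 3),
    fall (delta lam mu) 2 * (gamma lam mu - delta lam mu - 1),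
    fall (delta lam mu + 1) 2 * (gamma lam mu + delta lam mu - 1)]

/-- The simultaneous vanishing condition. -/
def SVC (lam mu lam' mu' : ℂ) : Prop :=
  ∀ j, svcFunction lam mu j = 0 ↔ svcFunction lam' mu' j = 0

/-- The rational invariant `R(γ,δ)`; only used where its denominator does not vanish. -/
def invR (g d : ℂ) : ℂ := g * (g - 3) / ((g - d - 1) * (g + d - 1))

/-- The conic `A γ² + B γδ + C δ² + D γ + E δ + F = 0` with coefficients `a = (A,B,C,D,E,F)`, in
the `(γ,δ)`-plane. -/
def conic (a : Fin 6 → ℂ) : Set (ℂ × ℂ) :=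
  {p | a 0 * p.1 ^ 2 + a 1 * (p.1 * p.2) + a 2 * p.2 ^ 2 + a 3 * p.1 + a 4 * p.2 + a 5 = 0}

end PseudoDiff

end

open PseudoDiff

/-!
The coefficients of `∂ₓ^(δ+1-i)`, for `i = 0, 1, 2, 3`, are densities of weights `-1, 0, 1, 2`,
whatever the parameters are. A linear map between such modules that commutes with `∂ₓ` and `x ∂ₓ`
is therefore a lower triangular matrix with entries `a i j ∂ₓ^(i-j)`
(`exists_triOp_of_equivariant`), and it is invertible when its diagonal has no zeros
(`nonempty_lieModuleEquiv_iff`). Equivalence is the solvability of the linear equations for the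
numbers `a i j` that express that such a matrix commutes with all vector fields
(`intertwines_iff_intertwiningEquations`).

Eliminating the entries below the diagonal leaves four equations, each of which relates two
entries of the diagonal and says that one of the four functions of the theorem is multiplied by
their ratio (`exists_intertwiningEquations_iff`). The four functions thus label the edges of a
`4`-cycle on the composition factors, and an equivalence is a rescaling of the vertices
(`equivalent_iff_exists_ratios`). If a label vanishes, then the cycle breaks and only the vanishing
of the labels matters. If no label vanishes, then the alternating product of the labels around the
cycle is the only invariant; it is `R(γ, δ)`, because the factors depending on `δ` alone
cancel (`invR_eq`).

The statement on conics is linear algebra on six coefficients, together with the remark that the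
numerator and the denominator of `R` vanish together at the four base points only.
-/

noncomputable section

namespace PseudoDiff

open Polynomial Finset

/-! ### Operators commuting with `∂ₓ` and the Euler field -/

/-- The Euler field forces `S (X ^ m)` to be a multiple of `X ^ (m - d)`, and commutation with the
derivative determines the multiples by induction on `m`, up to the constant term of `S (X ^ d)`. -/
lemma linearMap_eq_zero_of_commute (S : ℂ[X] →ₗ[ℂ] ℂ[X]) (d : ℂ)
    (hD : ∀ f, S (derivative f) = derivative (S f))
    (hE : ∀ f, S (X * derivative f) = X * derivative (S f) + C d * S f)
    (h0 : ∀ n : ℕ, d = n → (S (X ^ n)).coeff 0 = 0) : S = 0 := by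
  have hX : ∀ n : ℕ, X * derivative (X ^ n : ℂ[X]) = (n : ℂ) • X ^ n := by
    intro n
    cases n with
    | zero => simp
    | succ n => rw [derivative_X_pow, smul_eq_C_mul]; simp; ring
  have hS : ∀ m : ℕ, S (X ^ m) = 0 := by
    intro m
    induction m with
    | zero =>
      have h1 : derivative (S (X ^ 0)) = 0 := by rw [← hD]; simp
      rw [eq_C_of_derivative_eq_zero h1]
      have h2 := hE (X ^ 0)
      rw [h1, hX] at h2
      by_cases hd : d = 0
      · rw [h0 0 (by simpa using hd), C_0]
      · have h3 : C d * S (X ^ 0) = 0 := by simpa using h2.symm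
        rcases mul_eq_zero.1 h3 with h | h
        · exact absurd (C_eq_zero.1 h) hd
        · rw [h]; simp
    | succ m ih =>
      have h1 : derivative (S (X ^ (m + 1))) = 0 := by
        rw [← hD, derivative_X_pow, ← smul_eq_C_mul, map_smul, Nat.add_sub_cancel, ih, smul_zero]
      have h2 := hE (X ^ (m + 1))
      rw [h1, hX, map_smul, mul_zero, zero_add, smul_eq_C_mul] at h2
      by_cases hd : d = ((m + 1 : ℕ) : ℂ)
      · rw [eq_C_of_derivative_eq_zero h1, h0 _ hd, C_0]
      · have h3 : C (((m + 1 : ℕ) : ℂ) - d) * S (X ^ (m + 1)) = 0 := by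
          rw [C_sub, sub_mul, h2, sub_self]
        rcases mul_eq_zero.1 h3 with h | h
        · exact absurd (sub_eq_zero.1 (C_eq_zero.1 h)).symm hd
        · exact h
  refine lhom_ext' fun n => LinearMap.ext_ring ?_
  simpa [monomial_one_right_eq_X_pow] using hS n

lemma iterate_derivative_X_mul_derivative (n : ℕ) (f : ℂ[X]) :
    derivative^[n] (X * derivative f) =
      X * derivative (derivative^[n] f) + C (n : ℂ) * derivative^[n] f := by
  induction n with
  | zero => simp
  | succ n ih =>
    rw [Function.iterate_succ_apply', ih, Function.iterate_succ_apply' _ n f]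
    simp
    ring

/-- Equivariant maps for `∂ₓ` and `x ∂ₓ` from densities of weight `w + j` to densities of weight
`w + i` are the multiples of the power `i - j` of the derivative. -/
lemma exists_eq_mul_iterate_derivative (T : ℂ[X] →ₗ[ℂ] ℂ[X]) (w : ℂ) (i j : ℕ)
    (hD : ∀ f, T (derivative f) = derivative (T f))
    (hE : ∀ f, T (X * derivative f + C (w + j) * f) =
      X * derivative (T f) + C (w + i) * T f) :
    ∃ a : ℂ, ∀ f, T f = if j ≤ i then C a * derivative^[i - j] f else 0 := by
  have hE' : ∀ f, T (X * derivative f) =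
      X * derivative (T f) + C ((i : ℂ) - j) * T f := by
    intro f
    have h := hE f
    rw [map_add, ← smul_eq_C_mul, map_smul, smul_eq_C_mul] at h
    rw [eq_sub_of_add_eq h]
    simp only [C_add, C_sub]
    ring
  split_ifs with hij
  · have hn : ((i - j : ℕ) : ℂ) = (i : ℂ) - j := Nat.cast_sub hij
    set n := i - j
    refine ⟨(T (X ^ n)).coeff 0 / n.factorial, fun f => ?_⟩
    set a : ℂ := (T (X ^ n)).coeff 0 / n.factorial with ha
    have hz := linearMap_eq_zero_of_commute (T - a • derivative ^ n) n
      (fun f => by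
        simp only [LinearMap.sub_apply, LinearMap.smul_apply, Module.End.pow_apply, hD,
          derivative_sub, derivative_smul, ← Function.iterate_succ_apply,
          ← Function.iterate_succ_apply'])
      (fun f => by
        simp only [LinearMap.sub_apply, LinearMap.smul_apply, Module.End.pow_apply, hE', ← hn,
          derivative_sub, derivative_C_mul, iterate_derivative_X_mul_derivative, smul_eq_C_mul]
        ring)
      (fun m hm => by
        obtain rfl : n = m := by exact_mod_cast hm
        have : (n.factorial : ℂ) ≠ 0 := by exact_mod_cast n.factorial_ne_zero
        simp only [LinearMap.sub_apply, LinearMap.smul_apply, Module.End.pow_apply]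
        rw [iterate_derivative_X_pow_eq_C_mul]
        simp [ha, this, Nat.descFactorial_self])
    have h := LinearMap.congr_fun hz f
    rw [LinearMap.sub_apply, LinearMap.smul_apply, Module.End.pow_apply, LinearMap.zero_apply,
      sub_eq_zero] at h
    rw [h, smul_eq_C_mul]
  · refine ⟨0, fun f => ?_⟩
    rw [linearMap_eq_zero_of_commute T _ hD hE' fun m hm => ?_, LinearMap.zero_apply]
    have : (i : ℂ) = (m + j : ℕ) := by push_cast; linear_combination hm
    have : i = m + j := by exact_mod_cast this
    omega

/-! ### Triangular operators -/

/-- The lower triangular matrix of constant coefficient differential operators whose entry in row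
`i` and column `j ≤ i` is `a i j ∂ₓ^(i-j)`. -/
def triOp (a : ℕ → ℕ → ℂ) (f : ℕ → ℂ[X]) (i : ℕ) : ℂ[X] :=
  ∑ j ∈ range (i + 1), C (a i j) * derivative^[i - j] (f j)

lemma triOp_add (a : ℕ → ℕ → ℂ) (f f' : ℕ → ℂ[X]) (i : ℕ) :
    triOp a (f + f') i = triOp a f i + triOp a f' i := by
  simp [triOp, iterate_map_add, mul_add, Finset.sum_add_distrib]

lemma triOp_smul (a : ℕ → ℕ → ℂ) (c : ℂ) (f : ℕ → ℂ[X]) (i : ℕ) :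
    triOp a (c • f) i = c • triOp a f i := by
  simp [triOp, iterate_derivative_smul, Finset.smul_sum]

lemma triOp_eq_zero (a : ℕ → ℕ → ℂ) {f : ℕ → ℂ[X]} {i : ℕ} (h : ∀ j ≤ i, f j = 0) :
    triOp a f i = 0 := by
  refine Finset.sum_eq_zero fun j hj => ?_
  rw [h j (Nat.lt_succ_iff.1 (Finset.mem_range.1 hj)), iterate_derivative_zero, mul_zero]

lemma triOp_eq_of_lower_eq_zero (a : ℕ → ℕ → ℂ) {f : ℕ → ℂ[X]} {i : ℕ} (h : ∀ j < i, f j = 0) :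
    triOp a f i = C (a i i) * f i := by
  rw [triOp, Finset.sum_range_succ, Finset.sum_eq_zero, zero_add, Nat.sub_self]
  · rfl
  · intro j hj
    rw [h j (Finset.mem_range.1 hj), iterate_derivative_zero, mul_zero]

lemma eq_zero_of_triOp_eq_zero {a : ℕ → ℕ → ℂ} {l : ℕ} (ha : ∀ i < l, a i i ≠ 0)
    {f : ℕ → ℂ[X]} (h : ∀ i < l, triOp a f i = 0) : ∀ i < l, f i = 0 := by
  intro i
  induction i using Nat.strong_induction_on with
  | _ i ih =>
    intro hi
    have h1 := triOp_eq_of_lower_eq_zero a (f := f) fun j hj => ih j hj (hj.trans hi)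
    rw [h i hi] at h1
    rcases mul_eq_zero.1 h1.symm with h2 | h2
    · exact absurd (C_eq_zero.1 h2) (ha i hi)
    · exact h2

lemma exists_triOp_eq {a : ℕ → ℕ → ℂ} {l : ℕ} (ha : ∀ i < l, a i i ≠ 0) (h : ℕ → ℂ[X]) :
    ∃ f, ∀ i < l, triOp a f i = h i := by
  suffices H : ∀ n ≤ l, ∃ f, ∀ i < n, triOp a f i = h i from H l le_rfl
  intro n
  induction n with
  | zero => exact fun _ => ⟨0, by simp⟩
  | succ n ih =>
    intro hn
    obtain ⟨f, hf⟩ := ih (by omega)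
    set p : ℂ[X] := C (a n n)⁻¹ * (h n - triOp a f n)
    have hs : ∀ j, j ≠ n → (Pi.single n p : ℕ → ℂ[X]) j = 0 :=
      fun j hj => Pi.single_eq_of_ne hj _
    refine ⟨f + Pi.single n p, fun i hi => ?_⟩
    rw [triOp_add]
    rcases Nat.lt_succ_iff_lt_or_eq.1 hi with hi | rfl
    · rw [hf i hi, triOp_eq_zero a fun j hj => hs j (by omega), add_zero]
    · rw [triOp_eq_of_lower_eq_zero a fun j hj => hs j (by omega),
        Pi.single_eq_same, ← mul_assoc, ← C_mul, mul_inv_cancel₀ (ha i (by omega)), C_1, one_mul]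
      ring

/-! ### Isomorphisms of subquotients -/

lemma exists_vecR_apply_X (g : ℂ[X]) : ∃ D : VecR, D X = g :=
  ⟨mkDerivation ℂ g, mkDerivation_X _ _⟩

lemma psiAction_one (k lam mu : ℂ) (f : ℕ → ℂ[X]) (i : ℕ) :
    psiAction k lam mu 1 f i = derivative (f i) := by
  rw [psiAction, Finset.sum_eq_zero]
  · simp
  · intro s _
    rw [Function.iterate_succ_apply, derivative_one, iterate_derivative_zero]
    simp

lemma psiAction_X (k lam mu : ℂ) (f : ℕ → ℂ[X]) (i : ℕ) :
    psiAction k lam mu X f i = X * derivative (f i) + C (mu - lam - k + i) * f i := by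
  rw [psiAction, Finset.sum_eq_zero]
  · simp only [derivative_X, C_add, C_sub]
    ring
  · intro s hs
    obtain ⟨t, rfl⟩ := Nat.exists_eq_add_of_le' (Finset.mem_Icc.1 hs).1
    rw [Function.iterate_succ_apply, Function.iterate_succ_apply, derivative_X, derivative_one,
      iterate_derivative_zero]
    simp

section Quotient

variable {k lam mu : ℂ} {l : ℕ}

/-- The class in the subquotient of the formal sum with coefficients `f`. -/
def toSQ (k lam mu : ℂ) (l : ℕ) : (ℕ → ℂ[X]) →ₗ[ℂ] SQ k l lam mu where
  toFun f := LieSubmodule.Quotient.mk (N := lowerOrder k lam mu l) f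
  map_add' _ _ := rfl
  map_smul' _ _ := rfl

lemma toSQ_surjective : Function.Surjective (toSQ k lam mu l) :=
  Submodule.mkQ_surjective _

lemma toSQ_eq_zero_iff {f : ℕ → ℂ[X]} : toSQ k lam mu l f = 0 ↔ ∀ i < l, f i = 0 :=
  Submodule.Quotient.mk_eq_zero (lowerOrder k lam mu l).toSubmodule

lemma toSQ_eq_iff {f f' : ℕ → ℂ[X]} :
    toSQ k lam mu l f = toSQ k lam mu l f' ↔ ∀ i < l, f i = f' i := by
  rw [← sub_eq_zero, ← map_sub, toSQ_eq_zero_iff]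
  simp [sub_eq_zero]

lemma lie_toSQ (D : VecR) (f : ℕ → ℂ[X]) :
    ⁅D, toSQ k lam mu l f⁆ = toSQ k lam mu l (psiAction k lam mu (D X) f) :=
  rfl

/-- The coefficient of `∂ₓ^(k-i)`, which is well defined on the subquotient for `i < l`. -/
def coeffSQ (k lam mu : ℂ) {l i : ℕ} (hi : i < l) : SQ k l lam mu →ₗ[ℂ] ℂ[X] :=
  (lowerOrder k lam mu l).toSubmodule.liftQ (LinearMap.proj i : (ℕ → ℂ[X]) →ₗ[ℂ] ℂ[X])
    fun _ hf => hf i hi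

lemma coeffSQ_toSQ {i : ℕ} (hi : i < l) (f : ℕ → ℂ[X]) :
    coeffSQ k lam mu hi (toSQ k lam mu l f) = f i :=
  rfl

lemma toSQ_eq_sum_single (f : ℕ → ℂ[X]) :
    toSQ k lam mu l f = ∑ j ∈ range l, toSQ k lam mu l (Pi.single j (f j)) := by
  rw [← map_sum, toSQ_eq_iff]
  intro i hi
  rw [Finset.sum_apply, Finset.sum_eq_single_of_mem i (Finset.mem_range.2 hi), Pi.single_eq_same]
  intro j _ hj
  exact Pi.single_eq_of_ne hj.symm _

end Quotient

variable {k lam mu k' lam' mu' : ℂ} {l : ℕ}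

/-- An intertwining operator of subquotients with the same weights is lower triangular: each of
its entries commutes with `∂ₓ` and `x ∂ₓ`, so is a multiple of a power of `∂ₓ`. -/
lemma exists_triOp_of_equivariant (hw : mu - lam - k = mu' - lam' - k')
    (e : SQ k l lam mu →ₗ⁅ℂ,VecR⁆ SQ k' l lam' mu') :
    ∃ a : ℕ → ℕ → ℂ, ∀ f, e (toSQ k lam mu l f) = toSQ k' lam' mu' l (triOp a f) := by
  have key : ∀ i j : ℕ, ∃ a : ℂ, ∀ hi : i < l, ∀ p : ℂ[X],
      coeffSQ k' lam' mu' hi (e (toSQ k lam mu l (Pi.single j p))) =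
        if j ≤ i then C a * derivative^[i - j] p else 0 := by
    intro i j
    by_cases hi : i < l
    swap
    · exact ⟨0, fun h => absurd h hi⟩
    let T : ℂ[X] →ₗ[ℂ] ℂ[X] := coeffSQ k' lam' mu' hi ∘ₗ (e : SQ k l lam mu →ₗ[ℂ] _) ∘ₗ
      toSQ k lam mu l ∘ₗ LinearMap.single ℂ (fun _ : ℕ => ℂ[X]) j
    have hT : ∀ p, T p = coeffSQ k' lam' mu' hi (e (toSQ k lam mu l (Pi.single j p))) :=
      fun p => rfl
    have hlie : ∀ (D : VecR) (q : SQ k' l lam' mu'), ∃ f, coeffSQ k' lam' mu' hi q = f i ∧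
        coeffSQ k' lam' mu' hi ⁅D, q⁆ = psiAction k' lam' mu' (D X) f i := by
      intro D q
      obtain ⟨f, rfl⟩ := toSQ_surjective q
      exact ⟨f, rfl, rfl⟩
    obtain ⟨a, ha⟩ := exists_eq_mul_iterate_derivative T (mu - lam - k) i j
      (fun p => by
        obtain ⟨D, hD⟩ := exists_vecR_apply_X 1
        obtain ⟨f, h1, h2⟩ := hlie D (e (toSQ k lam mu l (Pi.single j p)))
        have h3 : (Pi.single j (derivative p) : ℕ → ℂ[X]) =
            psiAction k lam mu (D X) (Pi.single j p) := by
          funext m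
          rw [hD, psiAction_one]
          rcases eq_or_ne m j with rfl | hm
          · simp
          · simp [hm]
        rw [hT, hT, h3, ← lie_toSQ, LieModuleHom.map_lie, h2, h1, hD, psiAction_one])
      (fun p => by
        obtain ⟨D, hD⟩ := exists_vecR_apply_X X
        obtain ⟨f, h1, h2⟩ := hlie D (e (toSQ k lam mu l (Pi.single j p)))
        have h3 : (Pi.single j (X * derivative p + C (mu - lam - k + j) * p) : ℕ → ℂ[X]) =
            psiAction k lam mu (D X) (Pi.single j p) := by
          funext m
          rw [hD, psiAction_X]
          rcases eq_or_ne m j with rfl | hm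
          · simp
          · simp [hm]
        rw [hT, hT, h3, ← lie_toSQ, LieModuleHom.map_lie, h2, h1, hD, psiAction_X, hw])
    exact ⟨a, fun _ => ha⟩
  choose a ha using key
  refine ⟨a, fun f => ?_⟩
  obtain ⟨f', hf'⟩ := toSQ_surjective (e (toSQ k lam mu l f))
  rw [← hf', toSQ_eq_iff]
  intro i hi
  rw [← coeffSQ_toSQ (k := k') (lam := lam') (mu := mu') hi f', hf', toSQ_eq_sum_single, map_sum,
    map_sum, Finset.sum_congr rfl fun j _ => ha i j hi (f j), triOp, ← Finset.sum_filter]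
  refine Finset.sum_congr ?_ fun _ _ => rfl
  ext j
  simp only [Finset.mem_filter, Finset.mem_range]
  omega

/-- Two subquotients with the same weights are isomorphic if and only if some triangular operator
with nonzero diagonal intertwines the two actions on the first `l` coefficients. -/
theorem nonempty_lieModuleEquiv_iff (hw : mu - lam - k = mu' - lam' - k') :
    Nonempty (SQ k l lam mu ≃ₗ⁅ℂ,VecR⁆ SQ k' l lam' mu') ↔
      ∃ a : ℕ → ℕ → ℂ, (∀ i < l, a i i ≠ 0) ∧ ∀ g f, ∀ i < l,
        triOp a (psiAction k lam mu g f) i = psiAction k' lam' mu' g (triOp a f) i := by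
  constructor
  · rintro ⟨e⟩
    obtain ⟨a, ha⟩ := exists_triOp_of_equivariant hw e.toLieModuleHom
    refine ⟨a, fun i hi h0 => ?_, fun g f => ?_⟩
    · -- the derivative kills constants, so `e` multiplies the constant `1` in place `i` by `a i i`
      have h1 : toSQ k' lam' mu' l (triOp a (Pi.single i 1)) = 0 := by
        rw [toSQ_eq_zero_iff]
        intro m _
        refine Finset.sum_eq_zero fun j hj => ?_
        rcases eq_or_ne j i with rfl | hji
        · rw [Pi.single_eq_same]
          rcases eq_or_ne m j with rfl | hmj
          · rw [h0, C_0, zero_mul]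
          · have : m - j ≠ 0 := by have := Finset.mem_range.1 hj; omega
            rw [iterate_derivative_one (Nat.pos_of_ne_zero this), mul_zero]
        · rw [Pi.single_eq_of_ne hji, iterate_derivative_zero, mul_zero]
      rw [← ha] at h1
      have h2 : toSQ k lam mu l (Pi.single i 1) = 0 := by
        apply e.injective
        exact h1.trans (map_zero e.toLieModuleHom).symm
      have h3 := toSQ_eq_zero_iff.1 h2 i hi
      rw [Pi.single_eq_same] at h3
      exact one_ne_zero h3
    · obtain ⟨D, rfl⟩ := exists_vecR_apply_X g
      rw [← toSQ_eq_iff (k := k') (lam := lam') (mu := mu'), ← ha, ← lie_toSQ, ← lie_toSQ,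
        LieModuleHom.map_lie, ha]
  · rintro ⟨a, hd, ha⟩
    let T : (ℕ → ℂ[X]) →ₗ[ℂ] SQ k' l lam' mu' := toSQ k' lam' mu' l ∘ₗ
      { toFun := triOp a
        map_add' := fun f f' => funext (triOp_add a f f')
        map_smul' := fun c f => funext (triOp_smul a c f) }
    let E : SQ k l lam mu →ₗ[ℂ] SQ k' l lam' mu' :=
      (lowerOrder k lam mu l).toSubmodule.liftQ T fun f hf => by
        exact toSQ_eq_zero_iff.2 fun i hi => triOp_eq_zero a fun j hj => hf j (hj.trans_lt hi)
    have hE : ∀ f, E (toSQ k lam mu l f) = toSQ k' lam' mu' l (triOp a f) := fun f => rfl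
    let F : SQ k l lam mu →ₗ⁅ℂ,VecR⁆ SQ k' l lam' mu' :=
      { E with
        map_lie' := by
          intro D q
          obtain ⟨f, rfl⟩ := toSQ_surjective q
          change E ⁅D, toSQ k lam mu l f⁆ = ⁅D, E (toSQ k lam mu l f)⁆
          rw [lie_toSQ, hE, hE, lie_toSQ, toSQ_eq_iff]
          exact ha (D X) f }
    have hF : Function.Bijective E := by
      constructor
      · refine (injective_iff_map_eq_zero E).2 fun q hq => ?_
        obtain ⟨f, rfl⟩ := toSQ_surjective q
        rw [hE, toSQ_eq_zero_iff] at hq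
        exact toSQ_eq_zero_iff.2 (eq_zero_of_triOp_eq_zero hd hq)
      · intro q
        obtain ⟨h, rfl⟩ := toSQ_surjective q
        obtain ⟨f, hf⟩ := exists_triOp_eq hd h
        exact ⟨toSQ k lam mu l f, by rw [hE, toSQ_eq_iff]; exact hf⟩
    let G := Equiv.ofBijective E hF
    exact ⟨{ F with
      invFun := G.symm
      left_inv := G.left_inv
      right_inv := G.right_inv }⟩

/-! ### Equations for the entries of an intertwining operator -/

/-- The coefficient `binom(k-j, s) (λ + (k-j-s)/(s+1))` with `k = δ + 1`, with which the
coefficient of `∂ₓ^(k-j)` enters, with a minus sign, that of `∂ₓ^(k-j-s)` under the action. -/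
def lowerCoeff (lam mu : ℂ) (j s : ℕ) : ℂ :=
  Ring.choose (delta lam mu + 1 - j) s * (lam + ((delta lam mu + 1 - j) - s) / (s + 1))

/-- The action with weights `-1, 0, 1, 2, …` and lower coefficients `c`. -/
def selfDualAction (c : ℕ → ℕ → ℂ) (g : ℂ[X]) (f : ℕ → ℂ[X]) (i : ℕ) : ℂ[X] :=
  g * derivative (f i) + C ((i : ℂ) - 1) * derivative g * f i
    - ∑ s ∈ Finset.Icc 1 i, C (c (i - s) s) * derivative^[s + 1] g * f (i - s)

lemma psiAction_eq_selfDualAction (lam mu : ℂ) :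
    psiAction (delta lam mu + 1) lam mu = selfDualAction (lowerCoeff lam mu) := by
  funext g f i
  have : (mu - lam) - (delta lam mu + 1 - i) = (i : ℂ) - 1 := by rw [delta]; ring
  rw [psiAction, this]
  rfl

/-- The linear equations saying that the triangular operator with entries `a i j ∂ₓ^(i-j)`
intertwines the actions with lower coefficients `c` and `c'` in the places `0, 1, 2, 3`. They
are indexed by the place of the argument and the order of the derivatives of the vector field and
of the argument: `eqj_pq` comes from `g^(p) f_j^(q)`. -/
structure IntertwiningEquations (c c' a : ℕ → ℕ → ℂ) : Prop where
  eq0_20 : -a 1 0 - a 1 1 * c 0 1 + c' 0 1 * a 0 0 = 0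
  eq1_20 : -a 2 2 * c 1 1 + c' 1 1 * a 1 1 = 0
  eq2_20 : a 3 2 - a 3 3 * c 2 1 + c' 2 1 * a 2 2 = 0
  eq0_21 : -a 2 0 - a 2 1 * c 0 1 + c' 1 1 * a 1 0 = 0
  eq0_30 : -a 2 0 - a 2 1 * c 0 1 - a 2 2 * c 0 2 + c' 0 2 * a 0 0 = 0
  eq1_21 : a 3 1 - a 3 2 * c 1 1 + c' 2 1 * a 2 1 = 0
  eq1_30 : -a 3 2 * c 1 1 - a 3 3 * c 1 2 + c' 1 2 * a 1 1 = 0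
  eq0_22 : -a 3 1 * c 0 1 + c' 2 1 * a 2 0 = 0
  eq0_31 : -2 * a 3 0 - 2 * a 3 1 * c 0 1 - a 3 2 * c 0 2 + c' 1 2 * a 1 0 = 0
  eq0_40 : -a 3 0 - a 3 1 * c 0 1 - a 3 2 * c 0 2 - a 3 3 * c 0 3 + c' 0 3 * a 0 0 = 0

lemma selfDualAction_zero (c : ℕ → ℕ → ℂ) (g : ℂ[X]) (f : ℕ → ℂ[X]) :
    selfDualAction c g f 0 = g * derivative (f 0) - derivative g * f 0 := by
  simp [selfDualAction]
  ring

lemma selfDualAction_one (c : ℕ → ℕ → ℂ) (g : ℂ[X]) (f : ℕ → ℂ[X]) :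
    selfDualAction c g f 1 = g * derivative (f 1)
      - C (c 0 1) * derivative^[2] g * f 0 := by
  simp [selfDualAction]

lemma selfDualAction_two (c : ℕ → ℕ → ℂ) (g : ℂ[X]) (f : ℕ → ℂ[X]) :
    selfDualAction c g f 2 = g * derivative (f 2) + derivative g * f 2
      - C (c 1 1) * derivative^[2] g * f 1 - C (c 0 2) * derivative^[3] g * f 0 := by
  have : Finset.Icc 1 2 = {1, 2} := rfl
  rw [selfDualAction, this, Finset.sum_pair (by norm_num), show ((2 : ℕ) : ℂ) - 1 = 1 by norm_num,
    C_1]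
  ring

lemma selfDualAction_three (c : ℕ → ℕ → ℂ) (g : ℂ[X]) (f : ℕ → ℂ[X]) :
    selfDualAction c g f 3 = g * derivative (f 3) + 2 * derivative g * f 3
      - C (c 2 1) * derivative^[2] g * f 2 - C (c 1 2) * derivative^[3] g * f 1
      - C (c 0 3) * derivative^[4] g * f 0 := by
  have : Finset.Icc 1 3 = {1, 2, 3} := rfl
  rw [selfDualAction, this, Finset.sum_insert (by decide), Finset.sum_pair (by norm_num),
    show ((3 : ℕ) : ℂ) - 1 = 2 by norm_num, show (C 2 : ℂ[X]) = 2 from rfl]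
  ring

/-! The defect of the intertwining identity in each place, as a bilinear differential operator. -/

lemma triOp_selfDualAction_sub_zero (c c' a : ℕ → ℕ → ℂ) (g : ℂ[X]) (f : ℕ → ℂ[X]) :
    triOp a (selfDualAction c g f) 0 - selfDualAction c' g (triOp a f) 0 = 0 := by
  simp [triOp, selfDualAction_zero]
  ring

lemma triOp_selfDualAction_sub_one (c c' a : ℕ → ℕ → ℂ) (g : ℂ[X]) (f : ℕ → ℂ[X]) :
    triOp a (selfDualAction c g f) 1 - selfDualAction c' g (triOp a f) 1 =
      C (-a 1 0 - a 1 1 * c 0 1 + c' 0 1 * a 0 0) * (derivative^[2] g * f 0) := by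
  simp [triOp, selfDualAction_zero, selfDualAction_one, Finset.sum_range_succ]
  ring

lemma triOp_selfDualAction_sub_two (c c' a : ℕ → ℕ → ℂ) (g : ℂ[X]) (f : ℕ → ℂ[X]) :
    triOp a (selfDualAction c g f) 2 - selfDualAction c' g (triOp a f) 2 =
      C (-a 2 2 * c 1 1 + c' 1 1 * a 1 1) * (derivative^[2] g * f 1) +
      C (-a 2 0 - a 2 1 * c 0 1 + c' 1 1 * a 1 0) * (derivative^[2] g * derivative^[1] (f 0)) +
      C (-a 2 0 - a 2 1 * c 0 1 - a 2 2 * c 0 2 + c' 0 2 * a 0 0) *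
        (derivative^[3] g * f 0) := by
  simp [triOp, selfDualAction_zero, selfDualAction_one, selfDualAction_two, Finset.sum_range_succ]
  ring

lemma triOp_selfDualAction_sub_three (c c' a : ℕ → ℕ → ℂ) (g : ℂ[X]) (f : ℕ → ℂ[X]) :
    triOp a (selfDualAction c g f) 3 - selfDualAction c' g (triOp a f) 3 =
      C (a 3 2 - a 3 3 * c 2 1 + c' 2 1 * a 2 2) * (derivative^[2] g * f 2) +
      C (a 3 1 - a 3 2 * c 1 1 + c' 2 1 * a 2 1) * (derivative^[2] g * derivative^[1] (f 1)) +
      C (-a 3 2 * c 1 1 - a 3 3 * c 1 2 + c' 1 2 * a 1 1) * (derivative^[3] g * f 1) +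
      C (-a 3 1 * c 0 1 + c' 2 1 * a 2 0) * (derivative^[2] g * derivative^[2] (f 0)) +
      C (-2 * a 3 0 - 2 * a 3 1 * c 0 1 - a 3 2 * c 0 2 + c' 1 2 * a 1 0) *
        (derivative^[3] g * derivative^[1] (f 0)) +
      C (-a 3 0 - a 3 1 * c 0 1 - a 3 2 * c 0 2 - a 3 3 * c 0 3 + c' 0 3 * a 0 0) *
        (derivative^[4] g * f 0) := by
  simp [triOp, selfDualAction_zero, selfDualAction_one, selfDualAction_two,
    selfDualAction_three, Finset.sum_range_succ]
  rw [show (C 2 : ℂ[X]) = 2 from rfl]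
  ring

lemma eval_zero_iterate_derivative_X_pow (m p : ℕ) :
    (derivative^[p] (X ^ m : ℂ[X])).eval 0 = if p = m then (m.factorial : ℂ) else 0 := by
  rw [iterate_derivative_X_pow_eq_C_mul, eval_C_mul, eval_pow, eval_X]
  rcases lt_trichotomy p m with h | rfl | h
  · rw [if_neg h.ne, zero_pow (by omega), mul_zero]
  · simp [Nat.descFactorial_self]
  · rw [if_neg h.ne', Nat.descFactorial_of_lt h, Nat.cast_zero, zero_mul]

/-- The defects of the intertwining identity are isolated by evaluating it at `0` on monomials. -/
lemma intertwines_iff_intertwiningEquations {c c' a : ℕ → ℕ → ℂ} :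
    (∀ g f, ∀ i < 4, triOp a (selfDualAction c g f) i = selfDualAction c' g (triOp a f) i) ↔
      IntertwiningEquations c c' a := by
  constructor
  · intro h
    have H : ∀ i < 4, ∀ j m n : ℕ,
        (triOp a (selfDualAction c (X ^ m) (Pi.single j (X ^ n))) i -
          selfDualAction c' (X ^ m) (triOp a (Pi.single j (X ^ n))) i).eval 0 = 0 :=
      fun i hi j m n => by rw [h _ _ i hi, sub_self, eval_zero]
    have ev := eval_zero_iterate_derivative_X_pow
    -- at `g = X ^ p` and `f j = X ^ q` only the defect term with `g^(p) f_j^(q)` survives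
    constructor
    · have := H 1 (by norm_num) 0 2 0
      rw [triOp_selfDualAction_sub_one] at this
      simpa [ev, -Function.iterate_succ, Nat.factorial_ne_zero] using this
    · have := H 2 (by norm_num) 1 2 0
      rw [triOp_selfDualAction_sub_two] at this
      simpa [ev, -Function.iterate_succ, Nat.factorial_ne_zero] using this
    · have := H 3 (by norm_num) 2 2 0
      rw [triOp_selfDualAction_sub_three] at this
      simpa [ev, -Function.iterate_succ, Nat.factorial_ne_zero] using this
    · have := H 2 (by norm_num) 0 2 1
      rw [triOp_selfDualAction_sub_two] at this
      simpa [ev, -Function.iterate_succ, Nat.factorial_ne_zero] using this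
    · have := H 2 (by norm_num) 0 3 0
      rw [triOp_selfDualAction_sub_two] at this
      simpa [ev, -Function.iterate_succ, Nat.factorial_ne_zero] using this
    · have := H 3 (by norm_num) 1 2 1
      rw [triOp_selfDualAction_sub_three] at this
      simpa [ev, -Function.iterate_succ, Nat.factorial_ne_zero] using this
    · have := H 3 (by norm_num) 1 3 0
      rw [triOp_selfDualAction_sub_three] at this
      simpa [ev, -Function.iterate_succ, Nat.factorial_ne_zero] using this
    · have := H 3 (by norm_num) 0 2 2
      rw [triOp_selfDualAction_sub_three] at this
      simpa [ev, -Function.iterate_succ, Nat.factorial_ne_zero] using this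
    · have := H 3 (by norm_num) 0 3 1
      rw [triOp_selfDualAction_sub_three] at this
      simpa [ev, -Function.iterate_succ, Nat.factorial_ne_zero] using this
    · have := H 3 (by norm_num) 0 4 0
      rw [triOp_selfDualAction_sub_three] at this
      simpa [ev, -Function.iterate_succ, Nat.factorial_ne_zero] using this
  · rintro ⟨h1, h2, h3, h4, h5, h6, h7, h8, h9, h10⟩ g f i hi
    rw [← sub_eq_zero]
    interval_cases i
    · exact triOp_selfDualAction_sub_zero c c' a g f
    · rw [triOp_selfDualAction_sub_one, h1]
      simp
    · rw [triOp_selfDualAction_sub_two, h2, h4, h5]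
      simp
    · rw [triOp_selfDualAction_sub_three, h3, h6, h7, h8, h9, h10]
      simp

/-! ### Solving the equations -/

/-- A solution of the intertwining equations with diagonal `d`. The entry in place `(2, 1)` is
free, since `∂ₓ` intertwines the densities of weights `0` and `1`; it is taken to be `0`. The
values above the diagonal and from row `4` on play no role. -/
def intertwinerCoeff (c c' : ℕ → ℕ → ℂ) (d : ℕ → ℂ) : ℕ → ℕ → ℂ
  | 1, 0 => c' 0 1 * d 0 - d 1 * c 0 1
  | 2, 0 => c' 1 1 * (c' 0 1 * d 0 - d 1 * c 0 1)
  | 2, 1 => 0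
  | 3, 2 => d 3 * c 2 1 - c' 2 1 * d 2
  | 3, 1 => (d 3 * c 2 1 - c' 2 1 * d 2) * c 1 1
  | 3, 0 => c' 0 3 * d 0 - d 3 * c 0 3 - (d 3 * c 2 1 - c' 2 1 * d 2) * (c 1 1 * c 0 1 + c 0 2)
  | i, _ => d i

/-- Eliminating the entries below the diagonal leaves four equations for the diagonal. By
`hc` and `hc'`, the two equations for the entry in place `(3, 0)` are compatible. -/
lemma exists_intertwiningEquations_iff {c c' : ℕ → ℕ → ℂ}
    (hc : c 2 1 * c 0 2 + 2 * c 0 3 - c 0 1 * c 1 2 = 0)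
    (hc' : c' 2 1 * c' 0 2 + 2 * c' 0 3 - c' 0 1 * c' 1 2 = 0) :
    (∃ a : ℕ → ℕ → ℂ, (∀ i < 4, a i i ≠ 0) ∧ IntertwiningEquations c c' a) ↔
      ∃ d : ℕ → ℂ, (∀ i < 4, d i ≠ 0) ∧
        d 2 * c 1 1 = d 1 * c' 1 1 ∧
        d 3 * (c 0 1 * c 1 1 * c 2 1) = d 0 * (c' 0 1 * c' 1 1 * c' 2 1) ∧
        d 3 * (c 1 1 * c 2 1 + c 1 2) = d 1 * (c' 1 1 * c' 2 1 + c' 1 2) ∧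
        d 2 * (c 0 1 * c 1 1 - c 0 2) = d 0 * (c' 0 1 * c' 1 1 - c' 0 2) := by
  constructor
  · rintro ⟨a, ha, h⟩
    refine ⟨fun i => a i i, ha, ?_, ?_, ?_, ?_⟩
    · linear_combination -h.eq1_20
    · linear_combination -h.eq0_22 - c 0 1 * h.eq1_21 - c' 2 1 * h.eq0_21 -
        c' 2 1 * c' 1 1 * h.eq0_20 - c 0 1 * c 1 1 * h.eq2_20 - c 0 1 * c' 2 1 * h.eq1_20
    · linear_combination -h.eq1_30 - c 1 1 * h.eq2_20 - c' 2 1 * h.eq1_20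
    · linear_combination h.eq0_30 - h.eq0_21 - c' 1 1 * h.eq0_20 - c 0 1 * h.eq1_20
  · rintro ⟨d, hd, h0, h1, h2, h3⟩
    refine ⟨intertwinerCoeff c c' d, fun i hi => ?_, ?_⟩
    · interval_cases i <;> exact hd _ (by norm_num)
    · constructor <;> simp only [intertwinerCoeff]
      · ring
      · linear_combination -h0
      · ring
      · ring
      · linear_combination h3 - c 0 1 * h0
      · ring
      · linear_combination -h2 + c' 2 1 * h0
      · linear_combination -h1 + c' 2 1 * c 0 1 * h0
      · linear_combination d 3 * hc - d 0 * hc' + c 0 1 * h2 + c' 2 1 * h3 - h1 -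
          c 0 1 * c' 2 1 * h0
      · ring

lemma lowerCoeff_eq (lam mu : ℂ) (j s : ℕ) :
    lowerCoeff lam mu j s = (descPochhammer ℂ s).eval (delta lam mu + 1 - j) / s.factorial *
      (lam + ((delta lam mu + 1 - j) - s) / (s + 1)) := by
  rw [lowerCoeff, choose_eq]

section Invariants

variable (lam mu : ℂ)

lemma lowerCoeff_zero_one : lowerCoeff lam mu 0 1 = (delta lam mu + 1) * (lam + mu) / 2 := by
  simp [lowerCoeff_eq, delta]; ring

lemma lowerCoeff_one_one : lowerCoeff lam mu 1 1 = delta lam mu * (lam + mu - 1) / 2 := by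
  simp [lowerCoeff_eq, delta]; ring

lemma lowerCoeff_two_one : lowerCoeff lam mu 2 1 = (delta lam mu - 1) * (lam + mu - 2) / 2 := by
  simp [lowerCoeff_eq, delta]; ring

lemma lowerCoeff_zero_two :
    lowerCoeff lam mu 0 2 = (delta lam mu + 1) * delta lam mu * (4 * lam + 2 * mu - 2) / 12 := by
  simp [lowerCoeff_eq, delta, descPochhammer_succ_eval, Nat.factorial]; ring

lemma lowerCoeff_one_two :
    lowerCoeff lam mu 1 2 = delta lam mu * (delta lam mu - 1) * (4 * lam + 2 * mu - 4) / 12 := by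
  simp [lowerCoeff_eq, delta, descPochhammer_succ_eval, Nat.factorial]; ring

lemma lowerCoeff_zero_three :
    lowerCoeff lam mu 0 3 = (delta lam mu + 1) * delta lam mu * (delta lam mu - 1) *
      (3 * lam + mu - 2) / 24 := by
  simp [lowerCoeff_eq, delta, descPochhammer_succ_eval, Nat.factorial]; ring

/-- The relation that makes the two equations for the entry `∂ₓ³` compatible. -/
lemma lowerCoeff_relation :
    lowerCoeff lam mu 2 1 * lowerCoeff lam mu 0 2 + 2 * lowerCoeff lam mu 0 3 -
      lowerCoeff lam mu 0 1 * lowerCoeff lam mu 1 2 = 0 := by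
  rw [lowerCoeff_two_one, lowerCoeff_zero_two, lowerCoeff_zero_three, lowerCoeff_zero_one,
    lowerCoeff_one_two, delta]
  ring

lemma fall_two (x : ℂ) : fall x 2 = x * (x - 1) := by
  simp [fall, descPochhammer_succ_eval]

lemma fall_three (x : ℂ) : fall x 3 = x * (x - 1) * (x - 2) := by
  simp [fall, descPochhammer_succ_eval]

lemma sqrtGamma_sq : sqrtGamma lam mu ^ 2 = gamma lam mu := by
  have : ((Real.sqrt 3 : ℝ) : ℂ) ^ 2 = 3 := by
    rw [← Complex.ofReal_pow, Real.sq_sqrt (by norm_num)]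
    norm_num
  rw [sqrtGamma, gamma, mul_pow, this]

lemma svcFunction_zero : svcFunction lam mu 0 = 2 * Real.sqrt 3 * lowerCoeff lam mu 1 1 := by
  rw [lowerCoeff_one_one]
  simp [svcFunction, sqrtGamma]
  ring

lemma svcFunction_one :
    svcFunction lam mu 1 = 24 * Real.sqrt 3 *
      (lowerCoeff lam mu 0 1 * lowerCoeff lam mu 1 1 * lowerCoeff lam mu 2 1) := by
  rw [lowerCoeff_zero_one, lowerCoeff_one_one, lowerCoeff_two_one]
  simp [svcFunction, sqrtGamma, fall_three, gamma]
  ring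

lemma svcFunction_two :
    svcFunction lam mu 2 = 12 *
      (lowerCoeff lam mu 1 1 * lowerCoeff lam mu 2 1 + lowerCoeff lam mu 1 2) := by
  rw [lowerCoeff_one_one, lowerCoeff_two_one, lowerCoeff_one_two]
  simp [svcFunction, fall_two, gamma, delta]
  ring

lemma svcFunction_three :
    svcFunction lam mu 3 = 12 *
      (lowerCoeff lam mu 0 1 * lowerCoeff lam mu 1 1 - lowerCoeff lam mu 0 2) := by
  rw [lowerCoeff_zero_one, lowerCoeff_one_one, lowerCoeff_zero_two]
  simp [svcFunction, fall_two, gamma, delta]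
  ring

/-- Both sides of the cycle condition share the factor `(δ)₂ (δ+1)₂`, and their quotient is the
invariant. -/
lemma invR_eq (h2 : svcFunction lam mu 2 ≠ 0) (h3 : svcFunction lam mu 3 ≠ 0) :
    invR (gamma lam mu) (delta lam mu) =
      svcFunction lam mu 0 * svcFunction lam mu 1 /
        (svcFunction lam mu 2 * svcFunction lam mu 3) := by
  have hs := sqrtGamma_sq lam mu
  simp only [svcFunction, Matrix.cons_val, fall_two, fall_three, ne_eq, mul_eq_zero, not_or]
    at h2 h3 ⊢
  rw [invR, div_eq_div_iff (mul_ne_zero h2.2 h3.2)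
    (mul_ne_zero (mul_ne_zero (mul_ne_zero h2.1.1 h2.1.2) h2.2)
      (mul_ne_zero (mul_ne_zero h3.1.1 h3.1.2) h3.2)), ← hs]
  ring

end Invariants

/-- The four functions label the edges of a `4`-cycle on the four composition factors. An
equivalence is a rescaling of the factors, which multiplies the labels by ratios whose
alternating product around the cycle is `1`. -/
theorem equivalent_iff_exists_ratios (lam mu lam' mu' : ℂ) :
    Equivalent lam mu lam' mu' ↔
      ∃ r : Fin 4 → ℂ, (∀ j, r j ≠ 0 ∧ svcFunction lam' mu' j * r j = svcFunction lam mu j) ∧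
        r 0 * r 1 = r 2 * r 3 := by
  have hw : mu - lam - (delta lam mu + 1) = mu' - lam' - (delta lam' mu' + 1) := by
    simp [delta]
  rw [Equivalent, nonempty_lieModuleEquiv_iff hw]
  simp only [psiAction_eq_selfDualAction, intertwines_iff_intertwiningEquations]
  rw [exists_intertwiningEquations_iff (lowerCoeff_relation lam mu) (lowerCoeff_relation lam' mu')]
  have hs : ((Real.sqrt 3 : ℝ) : ℂ) ≠ 0 := by simp
  constructor
  · rintro ⟨d, hd, h0, h1, h2, h3⟩
    have d0 := hd 0 (by norm_num)
    have d1 := hd 1 (by norm_num)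
    have d2 := hd 2 (by norm_num)
    have d3 := hd 3 (by norm_num)
    refine ⟨![d 1 / d 2, d 0 / d 3, d 1 / d 3, d 0 / d 2], ?_, ?_⟩
    · intro j
      fin_cases j
      · refine ⟨div_ne_zero d1 d2, ?_⟩
        simp only [Fin.zero_eta, Matrix.cons_val, svcFunction_zero]
        field_simp
        linear_combination -h0
      · refine ⟨div_ne_zero d0 d3, ?_⟩
        simp only [Fin.mk_one, Matrix.cons_val, svcFunction_one]
        field_simp
        linear_combination -h1
      · refine ⟨div_ne_zero d1 d3, ?_⟩
        simp only [Fin.reduceFinMk, Matrix.cons_val, svcFunction_two]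
        field_simp
        linear_combination -h2
      · refine ⟨div_ne_zero d0 d2, ?_⟩
        simp only [Fin.reduceFinMk, Matrix.cons_val, svcFunction_three]
        field_simp
        linear_combination -h3
    · simp; ring
  · rintro ⟨r, hr, hc⟩
    obtain ⟨r0, h0⟩ := hr 0
    obtain ⟨r1, h1⟩ := hr 1
    obtain ⟨r2, h2⟩ := hr 2
    obtain ⟨r3, h3⟩ := hr 3
    rw [svcFunction_zero, svcFunction_zero] at h0
    rw [svcFunction_one, svcFunction_one] at h1
    rw [svcFunction_two, svcFunction_two] at h2
    rw [svcFunction_three, svcFunction_three] at h3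
    have k0 : lowerCoeff lam' mu' 1 1 * r 0 = lowerCoeff lam mu 1 1 :=
      mul_left_cancel₀ (mul_ne_zero two_ne_zero hs) (by linear_combination h0)
    have k1 : lowerCoeff lam' mu' 0 1 * lowerCoeff lam' mu' 1 1 * lowerCoeff lam' mu' 2 1 * r 1 =
        lowerCoeff lam mu 0 1 * lowerCoeff lam mu 1 1 * lowerCoeff lam mu 2 1 :=
      mul_left_cancel₀ (mul_ne_zero (by norm_num : (24 : ℂ) ≠ 0) hs) (by linear_combination h1)
    refine ⟨fun | 0 => 1 | 1 => r 0 / r 3 | 2 => 1 / r 3 | _ => 1 / r 1, fun i hi => ?_,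
      ?_, ?_, ?_, ?_⟩
    · interval_cases i
      · exact one_ne_zero
      · exact div_ne_zero r0 r3
      · exact one_div_ne_zero r3
      · exact one_div_ne_zero r1
    · change 1 / r 3 * _ = r 0 / r 3 * _
      rw [← k0]
      ring
    · change 1 / r 1 * _ = 1 * _
      rw [← k1]
      field_simp
    · change 1 / r 1 * _ = r 0 / r 3 * _
      field_simp
      linear_combination (-r 3 / 12) * h2 - (lowerCoeff lam' mu' 1 1 * lowerCoeff lam' mu' 2 1 +
        lowerCoeff lam' mu' 1 2) * hc
    · change 1 / r 3 * _ = 1 * _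
      field_simp
      linear_combination -h3 / 12

lemma svc_of_equivalent {lam mu lam' mu' : ℂ} (h : Equivalent lam mu lam' mu') :
    SVC lam mu lam' mu' := by
  obtain ⟨r, hr, -⟩ := (equivalent_iff_exists_ratios lam mu lam' mu').1 h
  intro j
  rw [← (hr j).2, mul_eq_zero, or_iff_left (hr j).1]

/-- If an edge of the cycle has label `0`, its ratio is arbitrary and can be chosen to satisfy the
cycle condition. -/
lemma equivalent_of_svc {lam mu lam' mu' : ℂ}
    (h0 : ∃ j, svcFunction lam mu j = 0 ∧ svcFunction lam' mu' j = 0)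
    (h : SVC lam mu lam' mu') : Equivalent lam mu lam' mu' := by
  rw [equivalent_iff_exists_ratios]
  have hr : ∀ j, ∃ r : ℂ, r ≠ 0 ∧ svcFunction lam' mu' j * r = svcFunction lam mu j := by
    intro j
    by_cases hj : svcFunction lam mu j = 0
    · exact ⟨1, one_ne_zero, by rw [hj, (h j).1 hj, zero_mul]⟩
    · have hj' := fun h' => hj ((h j).2 h')
      exact ⟨_, div_ne_zero hj hj', mul_div_cancel₀ _ hj'⟩
  choose r hr0 hr using hr
  obtain ⟨j₀, hj, hj'⟩ := h0
  suffices H : ∃ t, t ≠ 0 ∧ Function.update r j₀ t 0 * Function.update r j₀ t 1 =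
      Function.update r j₀ t 2 * Function.update r j₀ t 3 by
    obtain ⟨t, ht, hc⟩ := H
    refine ⟨Function.update r j₀ t, fun j => ?_, hc⟩
    rcases eq_or_ne j j₀ with rfl | hne
    · rw [Function.update_self]
      exact ⟨ht, by rw [hj, hj', zero_mul]⟩
    · rw [Function.update_of_ne hne]
      exact ⟨hr0 j, hr j⟩
  have r0 := hr0 0
  have r1 := hr0 1
  have r2 := hr0 2
  have r3 := hr0 3
  fin_cases j₀
  · exact ⟨r 2 * r 3 / r 1, by positivity, by simp [Function.update, r1]⟩
  · exact ⟨r 2 * r 3 / r 0, by positivity, by simp [Function.update]; field_simp⟩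
  · exact ⟨r 0 * r 1 / r 3, by positivity, by simp [Function.update, r3]⟩
  · exact ⟨r 0 * r 1 / r 2, by positivity, by simp [Function.update]; field_simp⟩

lemma equivalent_iff_invR_eq {lam mu lam' mu' : ℂ}
    (h : ∀ j, svcFunction lam mu j ≠ 0 ∧ svcFunction lam' mu' j ≠ 0) :
    Equivalent lam mu lam' mu' ↔
      invR (gamma lam mu) (delta lam mu) = invR (gamma lam' mu') (delta lam' mu') := by
  rw [equivalent_iff_exists_ratios, invR_eq lam mu (h 2).1 (h 3).1,
    invR_eq lam' mu' (h 2).2 (h 3).2,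
    div_eq_div_iff (mul_ne_zero (h 2).1 (h 3).1) (mul_ne_zero (h 2).2 (h 3).2)]
  constructor
  · rintro ⟨r, hr, hc⟩
    rw [← (hr 0).2, ← (hr 1).2, ← (hr 2).2, ← (hr 3).2]
    linear_combination svcFunction lam' mu' 0 * svcFunction lam' mu' 1 * svcFunction lam' mu' 2 *
      svcFunction lam' mu' 3 * hc
  · intro hR
    refine ⟨fun j => svcFunction lam mu j / svcFunction lam' mu' j, fun j =>
      ⟨div_ne_zero (h j).1 (h j).2, mul_div_cancel₀ _ (h j).2⟩, ?_⟩
    have h0 := (h 0).2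
    have h1 := (h 1).2
    have h2 := (h 2).2
    have h3 := (h 3).2
    field_simp
    linear_combination hR

/-! ### The pencil of conics -/

lemma basePoints_subset_conic_iff (a : Fin 6 → ℂ) :
    ({(0, 1), (0, -1), (3, 2), (3, -2)} : Set (ℂ × ℂ)) ⊆ conic a ↔
      ∃ s t : ℂ, a = s • ![1, 0, 0, -3, 0, 0] + t • ![1, 0, -1, -2, 0, 1] := by
  constructor
  · intro h
    have p1 : ((0, 1) : ℂ × ℂ) ∈ conic a := h (by simp)
    have p2 : ((0, -1) : ℂ × ℂ) ∈ conic a := h (by simp)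
    have p3 : ((3, 2) : ℂ × ℂ) ∈ conic a := h (by simp)
    have p4 : ((3, -2) : ℂ × ℂ) ∈ conic a := h (by simp)
    simp only [conic, Set.mem_ofPred_eq] at p1 p2 p3 p4
    have a4 : a 4 = 0 := by linear_combination (p1 - p2) / 2
    have a1 : a 1 = 0 := by linear_combination (p3 - p4) / 12 - a4 / 3
    have a2 : a 2 = -a 5 := by linear_combination (p1 + p2) / 2
    have a3 : a 3 = -3 * a 0 + a 5 := by linear_combination (p3 + p4) / 6 - 4 / 3 * a2
    refine ⟨a 0 - a 5, a 5, funext fun j => ?_⟩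
    fin_cases j
    · simp
    · simpa using a1
    · simpa using a2
    · simp [a3]; ring
    · simpa using a4
    · simp
  · rintro ⟨s, t, rfl⟩ p hp
    simp only [Set.mem_insert_iff, Set.mem_singleton_iff] at hp
    rcases hp with rfl | rfl | rfl | rfl <;> simp [conic] <;> ring

lemma levelSet_invR_eq (c : ℂ) :
    {p : ℂ × ℂ | (p.1 - p.2 - 1) * (p.1 + p.2 - 1) ≠ 0 ∧ invR p.1 p.2 = c} =
      conic (![1, 0, 0, -3, 0, 0] - c • ![1, 0, -1, -2, 0, 1]) \
        {(0, 1), (0, -1), (3, 2), (3, -2)} := by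
  have hconic : ∀ x y : ℂ, (x, y) ∈ conic (![1, 0, 0, -3, 0, 0] - c • ![1, 0, -1, -2, 0, 1]) ↔
      x * (x - 3) = c * ((x - y - 1) * (x + y - 1)) := by
    intro x y
    rw [← sub_eq_zero (a := x * (x - 3))]
    simp only [conic, Set.mem_ofPred_eq, Pi.sub_apply, Pi.smul_apply, Matrix.cons_val, smul_eq_mul]
    ring_nf
  ext ⟨x, y⟩
  rw [Set.mem_sdiff, hconic, Set.mem_ofPred_eq]
  simp only [Set.mem_insert_iff, Set.mem_singleton_iff, Prod.mk.injEq]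
  constructor
  · rintro ⟨hne, hR⟩
    refine ⟨(div_eq_iff hne).1 hR, ?_⟩
    rintro (⟨rfl, rfl⟩ | ⟨rfl, rfl⟩ | ⟨rfl, rfl⟩ | ⟨rfl, rfl⟩) <;> exact hne (by norm_num)
  · rintro ⟨hc, hp⟩
    have hne : (x - y - 1) * (x + y - 1) ≠ 0 := by
      intro h
      rw [h, mul_zero] at hc
      rcases mul_eq_zero.1 hc with hx | hx
      · subst hx
        have : (y - 1) * (y + 1) = 0 := by linear_combination -h
        rcases mul_eq_zero.1 this with hy | hy
        · exact hp (Or.inl ⟨rfl, by linear_combination hy⟩)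
        · exact hp (Or.inr (Or.inl ⟨rfl, by linear_combination hy⟩))
      · obtain rfl : x = 3 := by linear_combination hx
        have : (y - 2) * (y + 2) = 0 := by linear_combination -h
        rcases mul_eq_zero.1 this with hy | hy
        · exact hp (Or.inr (Or.inr (Or.inl ⟨rfl, by linear_combination hy⟩)))
        · exact hp (Or.inr (Or.inr (Or.inr ⟨rfl, by linear_combination hy⟩)))
    exact ⟨hne, (div_eq_iff hne).2 hc⟩

end PseudoDiff

end

theorem mainTheorem3 :
    -- equivalence implies the simultaneous vanishing condition
    (∀ lam mu lam' mu' : ℂ, Equivalent lam mu lam' mu' → SVC lam mu lam' mu') ∧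
    -- if one of the four functions vanishes on both modules, the condition is sufficient
    (∀ lam mu lam' mu' : ℂ,
      (∃ j, svcFunction lam mu j = 0 ∧ svcFunction lam' mu' j = 0) →
      SVC lam mu lam' mu' → Equivalent lam mu lam' mu') ∧
    -- if none of them vanishes on either module, equivalence is equality of the invariant
    (∀ lam mu lam' mu' : ℂ,
      (∀ j, svcFunction lam mu j ≠ 0 ∧ svcFunction lam' mu' j ≠ 0) →
      (Equivalent lam mu lam' mu' ↔
        invR (gamma lam mu) (delta lam mu) = invR (gamma lam' mu') (delta lam' mu'))) ∧
    -- the conics through the points `(0, ±1)`, `(3, ±2)` form the pencil spanned by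
    -- `γ (γ - 3)` and `(γ - δ - 1) (γ + δ - 1)`
    (∀ a : Fin 6 → ℂ,
      ({(0, 1), (0, -1), (3, 2), (3, -2)} : Set (ℂ × ℂ)) ⊆ conic a ↔
        ∃ s t : ℂ, a = s • ![1, 0, 0, -3, 0, 0] + t • ![1, 0, -1, -2, 0, 1]) ∧
    -- and the level curves of the invariant are members of it, without the base points
    (∀ c : ℂ,
      {p : ℂ × ℂ | (p.1 - p.2 - 1) * (p.1 + p.2 - 1) ≠ 0 ∧ invR p.1 p.2 = c} =
        conic (![1, 0, 0, -3, 0, 0] - c • ![1, 0, -1, -2, 0, 1]) \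
          {(0, 1), (0, -1), (3, 2), (3, -2)}) := by
  exact ⟨fun _ _ _ _ => svc_of_equivalent, fun _ _ _ _ => equivalent_of_svc,
    fun _ _ _ _ => equivalent_iff_invR_eq, basePoints_subset_conic_iff, levelSet_invR_eq⟩
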